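/- Let $\mathfrak g$ be a finite-dimensional real Lie algebra which is unimodular, i.e. $\operatorname{tr}(\operatorname{ad}_X)=0$ for every $X\in\mathfrak g$. Let $J$ be an abelian complex structure on $\mathfrak g$, i.e. an $\mathbb R$-linear endomorphism with $J^2=-\mathrm{id}$ and vanishing Nijenhuis tensor, such that $[JX,JY]=[X,Y]$ for all $X,Y\in\mathfrak g$ (the last condition in fact implies that the Nijenhuis tensor vanishes). Suppose that there is a symplectic form $\Omega$ on $\mathfrak g$ taming $J$, that is, a nondegenerate alternating bilinear form $\Omega:\mathfrak g\times\mathfrak g\to\mathbb R$ which is closed, $$\Omega([X,Y],Z)+\Omega([Y,Z],X)+\Omega([Z,X],Y)=0\qquad\text{for all }X,Y,Z\in\mathfrak g,$$ and satisfies $\Omega(X,JX)>0$ for every nonzero $X\in\mathfrak g$. Then $\mathfrak g$ is abelian, i.e. $[X,Y]=0$ for all $X,Y\in\mathfrak g$. -/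

import Mathlib

/-- A finite-dimensional real Lie algebra is unimodular if every adjoint operator is traceless. -/
def IsUnimodularLieAlgebra (𝔤 : Type*) [LieRing 𝔤] [LieAlgebra ℝ 𝔤] : Prop :=
  ∀ X : 𝔤, LinearMap.trace ℝ 𝔤 (LieAlgebra.ad ℝ 𝔤 X) = 0

/-- A complex structure on a real Lie algebra: an endomorphism of square `-1` whose Nijenhuis
tensor vanishes. -/
structure IsLieComplexStructure {𝔤 : Type*} [LieRing 𝔤] [LieAlgebra ℝ 𝔤]
    (J : 𝔤 →ₗ[ℝ] 𝔤) : Prop where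
  sq_eq_neg : ∀ X : 𝔤, J (J X) = -X
  integrable : ∀ X Y : 𝔤, ⁅J X, J Y⁆ - J ⁅J X, Y⁆ - J ⁅X, J Y⁆ - ⁅X, Y⁆ = 0

/-- A complex structure `J` is abelian if `[JX, JY] = [X, Y]` for all `X`, `Y`. -/
structure IsAbelianComplexStructure {𝔤 : Type*} [LieRing 𝔤] [LieAlgebra ℝ 𝔤]
    (J : 𝔤 →ₗ[ℝ] 𝔤) : Prop extends IsLieComplexStructure J where
  lie_map_map : ∀ X Y : 𝔤, ⁅J X, J Y⁆ = ⁅X, Y⁆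

/-- A symplectic form on a real Lie algebra: a nondegenerate alternating bilinear form which is
closed for the Chevalley–Eilenberg differential with trivial coefficients. -/
structure IsLieSymplecticForm {𝔤 : Type*} [LieRing 𝔤] [LieAlgebra ℝ 𝔤]
    (Ω : LinearMap.BilinForm ℝ 𝔤) : Prop where
  alt : Ω.IsAlt
  nondegenerate : Ω.Nondegenerate
  closed : ∀ X Y Z : 𝔤, Ω ⁅X, Y⁆ Z + Ω ⁅Y, Z⁆ X + Ω ⁅Z, X⁆ Y = 0

/-- The form `Ω` tames `J` if `Ω(X, JX) > 0` for every nonzero `X`. -/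
def Tames {𝔤 : Type*} [LieRing 𝔤] [LieAlgebra ℝ 𝔤]
    (Ω : LinearMap.BilinForm ℝ 𝔤) (J : 𝔤 →ₗ[ℝ] 𝔤) : Prop :=
  ∀ X : 𝔤, X ≠ 0 → 0 < Ω X (J X)

/-! The complex structure `J` turns `𝔤` into a complex vector space `V`, and
`A x y = ⁅x, y⁆ + J ⁅J x, y⁆` is the `(1,0)`-part of the bracket of a `(0,1)`-vector with a
`(1,0)`-vector.  It is conjugate-linear in `x` and linear in `y`.  The Jacobi identity says that the
operators `A x` commute and that `A (A x w) y` is symmetric in `x` and `y`.  A form `Ω` splits into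
its `(2,0)`-part, an alternating complex bilinear form `β`, and its `(1,1)`-part, a sesquilinear
form `h`; taming says that `h` is positive, and closedness links `β` and `h` by one identity.

The common kernel `K` of all `A w` is shown to be everything, which forces the bracket to vanish.
Otherwise the commuting operators induced on `V ⧸ K` have a common eigenvector, the class of
some `y ∉ K`, with weight `χ`.

* If `χ ≠ 0`, a lift can be corrected to a common eigenvector of weight `χ` in `V`.  For a common
  eigenvector `y`, the operator `A (A y w)` has rank at most one, so unimodularity gives
  `χ (A y w) = 0`; inserting `x = A y w` in the closedness identity then yields
  `h (A y w) (A y w) + |χ w|² h y y = 0`, hence `χ = 0` by positivity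
  (`weight_eq_zero_and_apply_eq_zero`).
* If `χ = 0`, then `A w y ∈ K` for all `w`.  Elements of `K` are central, and closedness, first for
  the central element `A y y` and then for the pair `A y w`, `y`, gives
  `h (A w y) (A w y) + h (A y w) (A y w) = 0`, hence `y ∈ K`
  (`apply_eq_zero_of_apply_mem_ker`). -/

/-! ### Common eigenvectors of commuting operators -/

/-- A pairwise commuting family of endomorphisms of a nonzero finite-dimensional space over an
algebraically closed field has a common eigenvector. -/
theorem Module.End.exists_common_eigenvector {k ι V : Type*} [Field k] [IsAlgClosed k]
    [AddCommGroup V] [Module k V] [FiniteDimensional k V] [Nontrivial V] (T : ι → V →ₗ[k] V)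
    (hT : ∀ i j v, T i (T j v) = T j (T i v)) :
    ∃ v : V, v ≠ 0 ∧ ∃ χ : ι → k, ∀ i, T i v = χ i • v := by
  induction hn : Module.finrank k V using Nat.strong_induction_on generalizing V with
  | _ n ih =>
    by_cases hs : ∀ i, ∃ c : k, ∀ v, T i v = c • v
    · choose χ hχ using hs
      obtain ⟨v, hv⟩ := exists_ne (0 : V)
      exact ⟨v, hv, χ, fun i => hχ i v⟩
    · push Not at hs
      obtain ⟨i, hi⟩ := hs
      obtain ⟨c, hc⟩ := Module.End.exists_eigenvalue (T i)
      -- An eigenspace of a non-scalar member of the family is proper, nonzero and invariant.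
      set E := Module.End.eigenspace (T i) c with hE
      have hmem : ∀ v, v ∈ E ↔ T i v = c • v := fun v => Module.End.mem_eigenspace_iff
      have hinv : ∀ j, ∀ v ∈ E, T j v ∈ E := fun j v hv => by
        rw [hmem] at hv ⊢
        rw [hT, hv, map_smul]
      have hne : E ≠ ⊤ := fun h => by
        obtain ⟨v, hv⟩ := hi c
        exact hv ((hmem v).1 (h ▸ Submodule.mem_top))
      have : Nontrivial E := (Submodule.nontrivial_iff_ne_bot).2 hc
      obtain ⟨v, hv, χ, hχ⟩ := ih (Module.finrank k E) (hn ▸ Submodule.finrank_lt hne)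
        (fun j => (T j).restrict (hinv j))
        (fun a b v => Subtype.ext (hT a b v)) rfl
      exact ⟨v, fun h => hv (Subtype.ext h), χ, fun j => congrArg Subtype.val (hχ j)⟩

/-! ### The vanishing theorem on the complex vector space -/

section Tamed

variable {V : Type*} [AddCommGroup V] [Module ℂ V]
  {A : V →ₗ⋆[ℂ] V →ₗ[ℂ] V} {β : V →ₗ[ℂ] V →ₗ[ℂ] ℂ} {h : V →ₗ[ℂ] V →ₗ⋆[ℂ] ℂ}

theorem eq_zero_of_re_nonpos (hpos : ∀ v, v ≠ 0 → 0 < (h v v).re) {v : V}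
    (hv : (h v v).re ≤ 0) : v = 0 := by
  by_contra hne
  exact absurd (hpos v hne) (not_lt.2 hv)

theorem re_nonneg_of_pos (hpos : ∀ v, v ≠ 0 → 0 < (h v v).re) (v : V) : 0 ≤ (h v v).re := by
  rcases eq_or_ne v 0 with rfl | hv
  · simp
  · exact (hpos v hv).le

/-- Unimodularity enters here: the weight of a common eigenvector `y` vanishes on all `A y w`,
since `A (A y w) x = χ (A x w) • y` has rank at most one and trace `χ (A y w)`. -/
theorem weight_apply_eq_zero
    (hsymm : ∀ x y w, A (A x w) y = A (A y w) x)
    (htr : ∀ (w y : V) (f : V →ₗ[ℂ] ℂ), (∀ x, A w x = f x • y) → f y = 0)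
    {y : V} (hy : y ≠ 0) {χ : V → ℂ} (hχ : ∀ w, A w y = χ w • y) (w : V) :
    χ (A y w) = 0 := by
  let f : V →ₗ[ℂ] ℂ :=
    { toFun := fun x => χ (A x w)
      map_add' := fun a b => smul_left_injective ℂ hy (by
        simp only [add_smul, ← hχ, map_add, LinearMap.add_apply])
      map_smul' := fun c a => smul_left_injective ℂ hy (by
        simp only [smul_eq_mul, RingHom.id_apply, mul_smul, ← hχ, map_smulₛₗ, LinearMap.smul_apply,
          Complex.conj_conj]) }
  exact htr (A y w) y f fun x => by rw [hsymm, hχ]; rfl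

/-- A common eigenvector of all `A w` has weight zero and is annihilated on both sides. -/
theorem weight_eq_zero_and_apply_eq_zero
    (hcomm : ∀ x y z, A x (A y z) = A y (A x z))
    (hsymm : ∀ x y w, A (A x w) y = A (A y w) x)
    (htr : ∀ (w y : V) (f : V →ₗ[ℂ] ℂ), (∀ x, A w x = f x • y) → f y = 0)
    (hβ : β.IsAlt) (hpos : ∀ v, v ≠ 0 → 0 < (h v v).re)
    (hclosed : ∀ w x y, β (A w x) y - β (A w y) x = Complex.I * (h x (A y w) - h y (A x w)))
    {y : V} (hy : y ≠ 0) {χ : V → ℂ} (hχ : ∀ w, A w y = χ w • y) (w : V) :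
    χ w = 0 ∧ A y w = 0 := by
  have hχA := weight_apply_eq_zero hsymm htr hy hχ
  have hyy : A y y = 0 := by
    have h1 := hχA y
    have h2 : A (χ y • y) y = 0 := by rw [← hχ y, hχ, h1, zero_smul]
    rw [map_smulₛₗ, LinearMap.smul_apply] at h2
    rcases smul_eq_zero.1 h2 with h3 | h3
    · rw [hχ, (map_eq_zero _).1 h3, zero_smul]
    · exact h3
  have hβy : ∀ x, β (A y x) y = -Complex.I * (starRingEnd ℂ (χ x) * h y y) := fun x => by
    have := hclosed y x y
    rw [hyy, hχ x, map_zero, LinearMap.zero_apply, map_zero, map_smulₛₗ, smul_eq_mul] at this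
    linear_combination this
  have key := hclosed w (A y w) y
  have hskew : β (A w y) (A y w) = Complex.I * (χ w * starRingEnd ℂ (χ w)) * h y y := by
    rw [hχ w, map_smul, LinearMap.smul_apply, smul_eq_mul, ← hβ.neg, hβy]
    ring
  rw [hcomm w y w, hβy, hsymm y w w, hχ (A w w), hskew, map_smulₛₗ, smul_eq_mul] at key
  -- The terms with `χ (A w w)` on the two sides of `key` cancel.
  have hsum : h (A y w) (A y w) + (χ w * starRingEnd ℂ (χ w)) * h y y = 0 := by
    have : Complex.I * (h (A y w) (A y w) + (χ w * starRingEnd ℂ (χ w)) * h y y) = 0 := by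
      linear_combination -key
    exact (mul_eq_zero.1 this).resolve_left Complex.I_ne_zero
  have hre := congrArg Complex.re hsum
  rw [Complex.mul_conj, Complex.add_re, Complex.re_ofReal_mul, Complex.zero_re] at hre
  have h1 := re_nonneg_of_pos hpos (A y w)
  have h2 := mul_nonneg (Complex.normSq_nonneg (χ w)) (hpos y hy).le
  refine ⟨?_, eq_zero_of_re_nonpos hpos (by linarith)⟩
  have h3 : Complex.normSq (χ w) * (h y y).re = 0 := by linarith
  exact Complex.normSq_eq_zero.1 ((mul_eq_zero.1 h3).resolve_right (hpos y hy).ne')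

/-- If every `A w` maps `y` into the common kernel of the family, then `y` is in that kernel. -/
theorem apply_eq_zero_of_apply_mem_ker
    (hcomm : ∀ x y z, A x (A y z) = A y (A x z))
    (hsymm : ∀ x y w, A (A x w) y = A (A y w) x)
    (hβ : β.IsAlt) (hpos : ∀ v, v ≠ 0 → 0 < (h v v).re)
    (hclosed : ∀ w x y, β (A w x) y - β (A w y) x = Complex.I * (h x (A y w) - h y (A x w)))
    (hcentral : ∀ z, (∀ w, A w z = 0) → A z = 0)
    {y : V} (hy : ∀ v w, A v (A w y) = 0) (w : V) : A w y = 0 := by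
  have hβk : ∀ z, (∀ w, A w z = 0) → ∀ a b, β (A a b) z = -Complex.I * h z (A b a) :=
    fun z hz a b => by
      have := hclosed a b z
      rw [hcentral z hz, hz] at this
      simp only [LinearMap.zero_apply, map_zero] at this
      linear_combination this
  have hyy : A y y = 0 := by
    refine eq_zero_of_re_nonpos hpos (le_of_eq ?_)
    have := hβk (A y y) (fun v => hy v y) y y
    rw [hβ] at this
    have h0 : h (A y y) (A y y) = 0 := by simpa using this.symm
    rw [h0, Complex.zero_re]
  have key := hclosed w (A y w) y
  -- `β (A y (A w w)) y` is the other quantity in which `h y (A (A w w) y)` occurs.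
  have key2 := hclosed y (A w w) y
  have hskew : β (A w y) (A y w) = Complex.I * h (A w y) (A w y) := by
    have := hβk (A w y) (fun v => hy v w) y w
    rw [← hβ.neg, this]
    ring
  rw [hcomm w y w, hsymm, hskew] at key
  rw [hyy] at key2
  simp only [LinearMap.zero_apply, map_zero] at key2
  have hsum : h (A w y) (A w y) + h (A y w) (A y w) = 0 := by
    have : Complex.I * (h (A w y) (A w y) + h (A y w) (A y w)) = 0 := by
      linear_combination key2 - key
    exact (mul_eq_zero.1 this).resolve_left Complex.I_ne_zero
  refine eq_zero_of_re_nonpos hpos ?_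
  have := congrArg Complex.re hsum
  rw [Complex.add_re, Complex.zero_re] at this
  linarith [re_nonneg_of_pos hpos (A y w)]

/-- The vanishing theorem: a commuting family `A` satisfying the symmetry, trace and closedness
identities for a positive `h` is zero. -/
theorem eq_zero_of_tamed [FiniteDimensional ℂ V]
    (hcomm : ∀ x y z, A x (A y z) = A y (A x z))
    (hsymm : ∀ x y w, A (A x w) y = A (A y w) x)
    (htr : ∀ (w y : V) (f : V →ₗ[ℂ] ℂ), (∀ x, A w x = f x • y) → f y = 0)
    (hβ : β.IsAlt) (hpos : ∀ v, v ≠ 0 → 0 < (h v v).re)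
    (hclosed : ∀ w x y, β (A w x) y - β (A w y) x = Complex.I * (h x (A y w) - h y (A x w)))
    (w x : V) : A w x = 0 := by
  have hweight : ∀ {y : V}, y ≠ 0 → ∀ {χ : V → ℂ}, (∀ w, A w y = χ w • y) →
      ∀ w, χ w = 0 ∧ A y w = 0 := fun hy _ hχ w =>
    weight_eq_zero_and_apply_eq_zero hcomm hsymm htr hβ hpos hclosed hy hχ w
  have hcentral : ∀ z, (∀ w, A w z = 0) → A z = 0 := fun z hz => by
    rcases eq_or_ne z 0 with rfl | hz0
    · exact map_zero A
    · exact LinearMap.ext fun w =>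
        (hweight hz0 (χ := fun _ => 0) (fun v => by rw [hz, zero_smul]) w).2
  let K : Submodule ℂ V := ⨅ v, LinearMap.ker (A v)
  have hK : ∀ {z}, z ∈ K ↔ ∀ v, A v z = 0 := by simp [K, Submodule.mem_iInf]
  suffices hKtop : K = ⊤ from hK.1 (hKtop ▸ Submodule.mem_top) w
  by_contra hne
  have : Nontrivial (V ⧸ K) := Submodule.Quotient.nontrivial_iff.2 hne
  have hle : ∀ v, K ≤ K.comap (A v) := fun v z hz => by
    rw [Submodule.mem_comap, hK.1 hz v]
    exact K.zero_mem
  obtain ⟨q, hq, χ, hχ⟩ := Module.End.exists_common_eigenvector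
    (fun v => K.mapQ K (A v) (hle v)) (fun a b q => by
      obtain ⟨z, rfl⟩ := K.mkQ_surjective q
      simp only [Submodule.mkQ_apply, Submodule.mapQ_apply, hcomm a b])
  obtain ⟨y, rfl⟩ := K.mkQ_surjective q
  have hyK : y ∉ K := fun hy => hq ((Submodule.Quotient.mk_eq_zero K).2 hy)
  have hsub : ∀ v, A v y - χ v • y ∈ K := fun v => by
    have := hχ v
    simp only [Submodule.mkQ_apply, Submodule.mapQ_apply] at this
    rwa [← Submodule.Quotient.mk_smul, Submodule.Quotient.eq] at this
  have hAA : ∀ u v, A u (A v y) = χ v • A u y := fun u v => by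
    have := hK.1 (hsub v) u
    rwa [map_sub, map_smul, sub_eq_zero] at this
  by_cases hχ0 : ∀ v, χ v = 0
  · refine hyK (hK.2 fun v => ?_)
    exact apply_eq_zero_of_apply_mem_ker hcomm hsymm hβ hpos hclosed hcentral
      (fun u v => by rw [hAA, hχ0, zero_smul]) v
  · obtain ⟨v₀, hv₀⟩ := not_forall.1 hχ0
    -- Modulo `K`, the vector `A v₀ y` is the nonzero multiple `χ v₀ • y` of `y`; commutativity makes
    -- it a genuine common eigenvector.
    have heig : ∀ v, A v (A v₀ y) = χ v • A v₀ y := fun v => by rw [hcomm, hAA]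
    have hne0 : A v₀ y ≠ 0 := fun h0 => hyK (by
      have := hsub v₀
      rw [h0, zero_sub, Submodule.neg_mem_iff] at this
      exact (K.smul_mem_iff hv₀).1 this)
    exact hv₀ (hweight hne0 heig v₀).1

end Tamed

/-! ### The complex data attached to an abelian complex structure -/

section Complexification

variable {𝔤 : Type*} [LieRing 𝔤] [LieAlgebra ℝ 𝔤] {J : 𝔤 →ₗ[ℝ] 𝔤}

theorem IsAbelianComplexStructure.lie_map_left (hJ : IsAbelianComplexStructure J) (x y : 𝔤) :
    ⁅J x, y⁆ = -⁅x, J y⁆ := by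
  have := hJ.lie_map_map x (J y)
  rw [hJ.sq_eq_neg, lie_neg] at this
  rw [← this, neg_neg]

/-- The `(1,0)`-part of the bracket of the `(0,1)`-vector of `x` with the `(1,0)`-vector of `y`,
under the identification `y ↦ y - i J y` of `𝔤` with the space of `(1,0)`-vectors. -/
def dolbeaultAction (J : 𝔤 →ₗ[ℝ] 𝔤) (x y : 𝔤) : 𝔤 := ⁅x, y⁆ + J ⁅J x, y⁆

theorem dolbeaultAction_map_left (hJ : IsAbelianComplexStructure J) (x y : 𝔤) :
    dolbeaultAction J (J x) y = -J (dolbeaultAction J x y) := by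
  simp only [dolbeaultAction, hJ.sq_eq_neg, map_add, neg_lie, map_neg]
  abel

theorem dolbeaultAction_map_right (hJ : IsAbelianComplexStructure J) (x y : 𝔤) :
    dolbeaultAction J x (J y) = J (dolbeaultAction J x y) := by
  simp only [dolbeaultAction, hJ.lie_map_map, map_add, hJ.sq_eq_neg, hJ.lie_map_left x y, map_neg]
  abel

theorem dolbeaultAction_comm (hJ : IsAbelianComplexStructure J) (x y z : 𝔤) :
    dolbeaultAction J x (dolbeaultAction J y z) = dolbeaultAction J y (dolbeaultAction J x z) := by
  have e : ∀ a b : 𝔤, dolbeaultAction J a (dolbeaultAction J b z) =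
      ⁅a, ⁅b, z⁆⁆ - ⁅J a, ⁅J b, z⁆⁆ + J (⁅J a, ⁅b, z⁆⁆ + ⁅a, ⁅J b, z⁆⁆) := fun a b => by
    have h1 : ⁅a, J ⁅J b, z⁆⁆ = -⁅J a, ⁅J b, z⁆⁆ := by
      rw [hJ.lie_map_left a, neg_neg]
    simp only [dolbeaultAction, lie_add, hJ.lie_map_map, h1, map_add]
    abel
  have h1 : ⁅x, ⁅y, z⁆⁆ - ⁅y, ⁅x, z⁆⁆ = ⁅J x, ⁅J y, z⁆⁆ - ⁅J y, ⁅J x, z⁆⁆ := by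
    rw [← lie_lie, ← lie_lie, hJ.lie_map_map]
  have h2 : ⁅J x, ⁅y, z⁆⁆ + ⁅x, ⁅J y, z⁆⁆ = ⁅J y, ⁅x, z⁆⁆ + ⁅y, ⁅J x, z⁆⁆ := by
    have h3 : ⁅J x, ⁅y, z⁆⁆ - ⁅y, ⁅J x, z⁆⁆ = -(⁅x, ⁅J y, z⁆⁆ - ⁅J y, ⁅x, z⁆⁆) := by
      rw [← lie_lie, ← lie_lie, hJ.lie_map_left, neg_lie]
    rw [← sub_eq_zero] at h3 ⊢
    rw [← h3]
    abel
  rw [e, e, h2]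
  congr 1
  rw [← sub_eq_zero] at h1 ⊢
  rw [← h1]
  abel

/-- Together with `dolbeaultAction_comm`, this is the Jacobi identity for two `(1,0)`-vectors and a
`(0,1)`-vector, split into types. -/
theorem dolbeaultAction_symm (hJ : IsAbelianComplexStructure J) (x y w : 𝔤) :
    dolbeaultAction J (dolbeaultAction J x w) y = dolbeaultAction J (dolbeaultAction J y w) x := by
  have e : ∀ a b : 𝔤, dolbeaultAction J (dolbeaultAction J a w) b =
      ⁅⁅a, w⁆, b⁆ - ⁅⁅J a, w⁆, J b⁆ - J (⁅⁅J a, w⁆, b⁆ + ⁅⁅a, w⁆, J b⁆) := fun a b => by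
    simp only [dolbeaultAction, add_lie, map_add, hJ.sq_eq_neg, neg_lie, map_neg, hJ.lie_map_left]
    abel
  have jac : ∀ a b : 𝔤, ⁅⁅a, w⁆, b⁆ - ⁅⁅b, w⁆, a⁆ = ⁅⁅a, b⁆, w⁆ := fun a b => by
    rw [lie_lie a b w, ← lie_skew b ⁅a, w⁆, ← lie_skew a ⁅b, w⁆]
    abel
  have h1 := jac x y
  rw [← hJ.lie_map_map x y, ← jac] at h1
  have h2 : ⁅⁅J x, w⁆, y⁆ + ⁅⁅x, w⁆, J y⁆ = ⁅⁅J y, w⁆, x⁆ + ⁅⁅y, w⁆, J x⁆ := by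
    have h3 := jac (J x) y
    rw [hJ.lie_map_left x y, neg_lie, ← jac] at h3
    rw [← sub_eq_zero] at h3 ⊢
    rw [← h3]
    abel
  rw [e, e, h2]
  congr 1
  rw [← sub_eq_zero] at h1 ⊢
  rw [← h1]
  abel

theorem isLieAbelian_of_dolbeaultAction_eq_zero (hJ : IsAbelianComplexStructure J)
    (h0 : ∀ x y, dolbeaultAction J x y = 0) : IsLieAbelian 𝔤 := by
  refine ⟨fun x y => ?_⟩
  have h1 := h0 x y
  have h2 := h0 y x
  -- The first summand of `dolbeaultAction` is skew in its arguments, the second is symmetric.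
  have h3 : ⁅J y, x⁆ = ⁅J x, y⁆ := by rw [hJ.lie_map_left x y, lie_skew]
  rw [dolbeaultAction] at h1 h2
  rw [h3, ← lie_skew] at h2
  have h4 : (2 : ℝ) • ⁅x, y⁆ = 0 := by
    rw [two_smul, ← sub_self (0 : 𝔤)]
    nth_rewrite 1 [← h1]
    rw [← h2]
    abel
  exact (smul_eq_zero.1 h4).resolve_left two_ne_zero

/-- Unimodularity makes the real traces of all `dolbeaultAction J w` vanish. -/
theorem trace_dolbeaultAction (hunimod : IsUnimodularLieAlgebra 𝔤)
    (hJ : IsAbelianComplexStructure J) (w : 𝔤) (T : 𝔤 →ₗ[ℝ] 𝔤)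
    (hT : ∀ x, T x = dolbeaultAction J w x) : LinearMap.trace ℝ 𝔤 T = 0 := by
  have e : T = LieAlgebra.ad ℝ 𝔤 w + J * LieAlgebra.ad ℝ 𝔤 (J w) := LinearMap.ext fun x => by
    simp [hT, dolbeaultAction]
  -- Cyclicity of the trace and `ad (J w) ∘ J = ad w` remove `J` from the second summand.
  have e2 : LieAlgebra.ad ℝ 𝔤 (J w) * J = LieAlgebra.ad ℝ 𝔤 w := LinearMap.ext fun x => by
    simp [hJ.lie_map_map]
  rw [e, map_add, LinearMap.trace_mul_comm, e2, hunimod, add_zero]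

/-- The real part of the closedness identity of `Ω` on the `(1,0)`-vectors of `x`, `y` and the
`(0,1)`-vector of `w`; the imaginary part is this statement at `J w`.  It is the combination of the
closedness identities at `(w, x, y)`, `(J w, x, J y)`, `(J w, J x, y)` and `(w, J x, J y)` in which
the brackets of `x` with `y` cancel. -/
theorem closed_re (hJ : IsAbelianComplexStructure J) {Ω : LinearMap.BilinForm ℝ 𝔤}
    (hΩ : IsLieSymplecticForm Ω) (w x y : 𝔤) :
    (Ω (dolbeaultAction J w x) y - Ω (J (dolbeaultAction J w x)) (J y)) -
      (Ω (dolbeaultAction J w y) x - Ω (J (dolbeaultAction J w y)) (J x)) =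
    (Ω x (dolbeaultAction J y w) + Ω (J x) (J (dolbeaultAction J y w))) -
      (Ω y (dolbeaultAction J x w) + Ω (J y) (J (dolbeaultAction J x w))) := by
  have hskew : ∀ a b, Ω a b = -Ω b a := fun a b => (LinearMap.BilinForm.IsAlt.neg_eq hΩ.alt b a).symm
  have hx : ⁅J x, w⁆ = ⁅J w, x⁆ := by rw [hJ.lie_map_left w x, lie_skew]
  have hy : ⁅J y, w⁆ = ⁅J w, y⁆ := by rw [hJ.lie_map_left w y, lie_skew]
  have hwx : ⁅w, J x⁆ = -⁅J w, x⁆ := by rw [hJ.lie_map_left w x, neg_neg]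
  have h1 := hΩ.closed w x y
  have h2 := hΩ.closed (J w) x (J y)
  have h3 := hΩ.closed (J w) (J x) y
  have h4 := hΩ.closed w (J x) (J y)
  rw [← lie_skew y w] at h1
  rw [hJ.lie_map_map, ← lie_skew y w] at h2
  rw [hJ.lie_map_map, ← lie_skew y (J w), hJ.lie_map_left x y] at h3
  rw [hJ.lie_map_map, hy, hwx] at h4
  simp only [dolbeaultAction, hx, hy, ← lie_skew x w, ← lie_skew y w, map_add, map_neg,
    hJ.sq_eq_neg, LinearMap.add_apply, LinearMap.neg_apply] at h1 h2 h3 h4 ⊢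
  rw [hskew x ⁅w, y⁆, hskew x (J ⁅J w, y⁆), hskew (J x) (J ⁅w, y⁆), hskew (J x) ⁅J w, y⁆,
    hskew y ⁅w, x⁆, hskew y (J ⁅J w, x⁆), hskew (J y) (J ⁅w, x⁆), hskew (J y) ⁅J w, x⁆]
  linear_combination h1 + h2 + h3 - h4

/-- The complex vector space structure on `𝔤` for which `J` is multiplication by `i`. -/
abbrev complexModule (hJ : IsAbelianComplexStructure J) : Module ℂ 𝔤 where
  smul c x := c.re • x + c.im • J x
  one_smul x := by
    change (1 : ℝ) • x + (0 : ℝ) • J x = x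
    simp
  mul_smul a b x := by
    change (a * b).re • x + (a * b).im • J x =
      a.re • (b.re • x + b.im • J x) + a.im • J (b.re • x + b.im • J x)
    simp only [Complex.mul_re, Complex.mul_im, map_add, map_smul, hJ.sq_eq_neg]
    module
  smul_zero c := by
    change c.re • (0 : 𝔤) + c.im • J 0 = 0
    simp
  smul_add c x y := by
    change c.re • (x + y) + c.im • J (x + y) = c.re • x + c.im • J x + (c.re • y + c.im • J y)
    rw [map_add]
    module
  add_smul a b x := by
    change (a + b).re • x + (a + b).im • J x = a.re • x + a.im • J x + (b.re • x + b.im • J x)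
    rw [Complex.add_re, Complex.add_im]
    module
  zero_smul x := by
    change (0 : ℝ) • x + (0 : ℝ) • J x = 0
    simp

end Complexification

theorem mainTheorem6 {𝔤 : Type*} [LieRing 𝔤] [LieAlgebra ℝ 𝔤] [FiniteDimensional ℝ 𝔤]
    (J : 𝔤 →ₗ[ℝ] 𝔤) (hunimod : IsUnimodularLieAlgebra 𝔤) (hJ : IsAbelianComplexStructure J)
    (hΩ : ∃ Ω : LinearMap.BilinForm ℝ 𝔤, IsLieSymplecticForm Ω ∧ Tames Ω J) :
    IsLieAbelian 𝔤 := by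
  obtain ⟨Ω, hΩ, htame⟩ := hΩ
  -- The given real structure is named because a complex one induces a second instance.
  let hR : Module ℝ 𝔤 := inferInstance
  let : Module ℂ 𝔤 := complexModule hJ
  have smul_def : ∀ (c : ℂ) (x : 𝔤), c • x = c.re • x + c.im • J x := fun _ _ => rfl
  have hskew : ∀ a b, Ω a b = -Ω b a := fun a b => (LinearMap.BilinForm.IsAlt.neg_eq hΩ.alt b a).symm
  have : @IsScalarTower ℝ ℂ 𝔤 _ _ hR.toSMul := ⟨fun r c x => by
    rw [smul_def, smul_def, Complex.smul_re, Complex.smul_im, smul_add, smul_eq_mul, smul_eq_mul,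
      mul_smul, mul_smul]⟩
  have : FiniteDimensional ℂ 𝔤 := Module.Finite.of_restrictScalars_finite ℝ ℂ 𝔤
  let A : 𝔤 →ₗ⋆[ℂ] 𝔤 →ₗ[ℂ] 𝔤 := LinearMap.mk₂'ₛₗ (starRingEnd ℂ) (RingHom.id ℂ)
    (dolbeaultAction J)
    (fun x y z => by
      simp only [dolbeaultAction, map_add, add_lie]
      abel)
    (fun c x y => by
      have h1 : dolbeaultAction J (c.re • x + c.im • J x) y =
          c.re • dolbeaultAction J x y + c.im • dolbeaultAction J (J x) y := by
        simp only [dolbeaultAction, map_add, map_smul, add_lie, smul_lie]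
        module
      rw [smul_def, smul_def, h1, dolbeaultAction_map_left hJ, Complex.conj_re, Complex.conj_im]
      module)
    (fun x y z => by
      simp only [dolbeaultAction, map_add, lie_add]
      abel)
    (fun c x y => by
      have h1 : dolbeaultAction J x (c.re • y + c.im • J y) =
          c.re • dolbeaultAction J x y + c.im • dolbeaultAction J x (J y) := by
        simp only [dolbeaultAction, map_add, map_smul, lie_add, lie_smul]
        module
      rw [RingHom.id_apply, smul_def, smul_def, h1, dolbeaultAction_map_right hJ])
  -- The value of `Ω` on the `(1,0)`-vectors of `x` and `y`.
  let β : 𝔤 →ₗ[ℂ] 𝔤 →ₗ[ℂ] ℂ := LinearMap.mk₂ ℂ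
    (fun x y => ⟨Ω x y - Ω (J x) (J y), -(Ω (J x) y + Ω x (J y))⟩)
    (fun x y z => by
      apply Complex.ext <;> simp only [map_add, LinearMap.add_apply, Complex.add_re, Complex.add_im]
        <;> ring)
    (fun c x y => by
      apply Complex.ext <;> simp [smul_def, hJ.sq_eq_neg] <;> ring)
    (fun x y z => by
      apply Complex.ext <;> simp only [map_add, Complex.add_re, Complex.add_im] <;> ring)
    (fun c x y => by
      apply Complex.ext <;> simp [smul_def, hJ.sq_eq_neg] <;> ring)
  -- `-i` times the value of `Ω` on the `(1,0)`-vector of `x` and the `(0,1)`-vector of `y`.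
  let h : 𝔤 →ₗ[ℂ] 𝔤 →ₗ⋆[ℂ] ℂ := LinearMap.mk₂'ₛₗ (RingHom.id ℂ) (starRingEnd ℂ)
    (fun x y => ⟨Ω x (J y) - Ω (J x) y, -(Ω x y + Ω (J x) (J y))⟩)
    (fun x y z => by
      apply Complex.ext <;> simp only [map_add, LinearMap.add_apply, Complex.add_re, Complex.add_im]
        <;> ring)
    (fun c x y => by
      apply Complex.ext <;> simp [smul_def, hJ.sq_eq_neg] <;> ring)
    (fun x y z => by
      apply Complex.ext <;> simp only [map_add, Complex.add_re, Complex.add_im] <;> ring)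
    (fun c x y => by
      apply Complex.ext <;> simp [smul_def, hJ.sq_eq_neg] <;> ring)
  refine isLieAbelian_of_dolbeaultAction_eq_zero hJ
    (eq_zero_of_tamed (A := A) (β := β) (h := h) (dolbeaultAction_comm hJ)
      (dolbeaultAction_symm hJ) ?_ ?_ ?_ ?_)
  · intro w y f hf
    have hre : ∀ w (f : 𝔤 →ₗ[ℂ] ℂ), (∀ x, dolbeaultAction J w x = f x • y) → (f y).re = 0 := by
      intro w f hf
      have hfJ : ∀ x, f (J x) = Complex.I * f x := fun x => by
        rw [← smul_eq_mul, ← map_smul, smul_def, Complex.I_re, Complex.I_im, zero_smul, one_smul,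
          zero_add]
      have hfr : ∀ (r : ℝ) x, f (r • x) = r * f x := fun r x => by
        rw [← smul_eq_mul, ← map_smul, smul_def, Complex.ofReal_re, Complex.ofReal_im, zero_smul,
          add_zero]
      let fre : 𝔤 →ₗ[ℝ] ℝ :=
        { toFun := fun x => (f x).re
          map_add' := fun a b => by rw [map_add, Complex.add_re]
          map_smul' := fun r a => by
            rw [hfr, Complex.re_ofReal_mul, smul_eq_mul, RingHom.id_apply] }
      let fim : 𝔤 →ₗ[ℝ] ℝ :=
        { toFun := fun x => (f x).im
          map_add' := fun a b => by rw [map_add, Complex.add_im]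
          map_smul' := fun r a => by
            rw [hfr, Complex.im_ofReal_mul, smul_eq_mul, RingHom.id_apply] }
      have htr := trace_dolbeaultAction hunimod hJ w (fre.smulRight y + fim.smulRight (J y))
        (fun x => (hf x).symm)
      rw [map_add, LinearMap.trace_smulRight, LinearMap.trace_smulRight] at htr
      change (f y).re + (f (J y)).im = 0 at htr
      rw [hfJ, Complex.I_mul_im] at htr
      linarith
    -- The real trace only sees the real part of `f y`; replacing `w` by `J w` gives the other part.
    refine Complex.ext (hre w f hf) ?_
    have := hre (J w) (-Complex.I • f) fun x => by
      rw [dolbeaultAction_map_left hJ, LinearMap.smul_apply, smul_eq_mul, mul_smul, ← hf x, smul_def]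
      simp [A]
    simpa using this
  · intro x
    apply Complex.ext
    · simp [β, hΩ.alt x, hΩ.alt (J x)]
    · simp [β, hskew x (J x)]
  · intro v hv
    have := htame v hv
    change 0 < Ω v (J v) - Ω (J v) v
    rw [hskew (J v) v]
    linarith
  · intro w x y
    apply Complex.ext
    · have := closed_re hJ hΩ w x y
      simp only [A, β, h, LinearMap.mk₂_apply, LinearMap.mk₂'ₛₗ_apply, Complex.sub_re,
        Complex.I_mul_re, Complex.sub_im]
      linarith
    · have := closed_re hJ hΩ (J w) x y
      have e : ∀ a, dolbeaultAction J a (J w) = J (dolbeaultAction J a w) := fun a =>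
        dolbeaultAction_map_right hJ a w
      simp only [dolbeaultAction_map_left hJ, e, map_neg, hJ.sq_eq_neg, LinearMap.neg_apply] at this
      simp only [A, β, h, LinearMap.mk₂_apply, LinearMap.mk₂'ₛₗ_apply, Complex.sub_im,
        Complex.I_mul_im, Complex.sub_re]
      linarith
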